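/- **Corollary 4.1 (full-depth exponential rate).** Let $m\ge 2$, $D\ge 0$, $A=\{0,1,\ldots,m-1\}$, and let $\mathcal T(D)$ be the (finite) set of proper $m$-ary trees (every node has either $0$ or $m$ children) of depth at most $D$. A tree $T$ is identified with the collection of its leaves, and a leaf with the string of symbols $s$ on the path from the root to it, so that the $m$ children of a node $s$ are $sj$, $j\in A$. A process $\{X_i\}_{i\ge -D+1}$ with values in $A$ is a *variable-memory chain* with model $T\in\mathcal T(D)$ and parameters $\theta=\{\theta_s;\,s\in T\}$, each $\theta_s$ a probability vector on $A$, if for every $i\ge 1$ the conditional distribution of $X_i$ given the whole past $X_{-D+1}^{i-1}$ is $\theta_s$, where $s$ is the unique leaf of $T$ that is an initial segment of $(X_{i-1},X_{i-2},\ldots,X_{i-D})$; the distribution of the initial context $X_{-D+1}^0$ is arbitrary. The chain is *positive-ergodic* if all $\theta_s(j)$ are nonzero, and $T$ is its *minimal model* if, whenever all of $sj$, $j\in A$, are leaves of $T$, there are $j\ne j'$ with $\theta_{sj}\neq\theta_{sj'}$. For $\beta\in(0,1)$ let $\alpha=(1-\beta)^{1/(m-1)}$, and let $\pi_D(T;\beta)=\alpha^{|T|-1}\beta^{|T|-L_D(T)}$,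 where $|T|$ is the number of leaves of $T$ and $L_D(T)$ the number of its leaves at depth $D$. Given $T$, let the vectors $\theta_s$, $s\in T$, be independent with the Dirichlet distribution $\mathrm{Dir}(1/2,\ldots,1/2)$; write $\pi(d\theta|T)$ for their joint law. For a time series $x=x_{-D+1}^n$ let $P(x|T,\theta)=\prod_{i=1}^n\theta_{s_i}(x_i)$, where $s_i$ is the leaf of $T$ that is an initial segment of $(x_{i-1},\ldots,x_{i-D})$, and define the model posterior $$\pi(T|x)=\frac{\pi_D(T;\beta)\int P(x|T,\theta)\,\pi(d\theta|T)}{\sum_{S\in\mathcal T(D)}\pi_D(S;\beta)\int P(x|S,\theta)\,\pi(d\theta|S)},\qquad T\in\mathcal T(D).$$ Suppose $\{X_i\}$ is a positive-ergodic variable-memory chain whose minimal model $T^*$ is the complete $m$-ary tree of depth $D$. Then there is a (deterministic) constant $c>0$, not depending on $\beta$, such that, for every $\beta\in(0,1)$, almost surely, as $n\to\infty$, $$\pi(T^*|X_{-D+1}^n)\to 1\qquad\text{and}\qquad \pi(T^*|X_{-D+1}^n)=1-O(e^{-cn}).$$ -/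

import Mathlib

open MeasureTheory ProbabilityTheory Filter Topology Asymptotics

namespace BCT

/-- Proper `m`-ary trees: every node is either a leaf or has exactly `m` children. -/
inductive PTree (m : ℕ) : Type
  | leaf : PTree m
  | node (children : Fin m → PTree m) : PTree m

namespace PTree

variable {m : ℕ}

def depth : PTree m → ℕ
  | leaf => 0
  | node c => (Finset.univ.sup fun j => (c j).depth) + 1

/-- The leaves of a tree, each as the string of symbols along the path from the root to it. -/
def leaves : PTree m → Finset (List (Fin m))
  | leaf => {[]}
  | node c => Finset.univ.biUnion fun j => (c j).leaves.image (List.cons j)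

/-- The complete `m`-ary tree of depth `D`. -/
def complete (m : ℕ) : ℕ → PTree m
  | 0 => leaf
  | D + 1 => node fun _ => complete m D

/-- The leaf reached from the root by reading the past, most recent symbol first: `past 0` is the
previous symbol, `past 1` the one before it, and so on. -/
def path : PTree m → (ℕ → Fin m) → List (Fin m)
  | leaf, _ => []
  | node c, past => past 0 :: (c (past 0)).path fun k => past (k + 1)

theorem path_mem_leaves (T : PTree m) (past : ℕ → Fin m) : T.path past ∈ T.leaves := by
  induction T generalizing past with
  | leaf => simp [path, leaves]
  | node c ih =>
    simp only [path, leaves, Finset.mem_biUnion, Finset.mem_univ, true_and, Finset.mem_image]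
    exact ⟨past 0, _, ih _ _, rfl⟩

/-- The unique leaf of `T` that is a suffix of the past. -/
def leafOf (T : PTree m) (past : ℕ → Fin m) : T.leaves :=
  ⟨T.path past, T.path_mem_leaves past⟩

theorem finite_depth_le (m D : ℕ) : {T : PTree m | T.depth ≤ D}.Finite := by
  induction D with
  | zero =>
    refine (Set.finite_singleton (leaf : PTree m)).subset fun T hT => ?_
    cases T with
    | leaf => rfl
    | node c => simp [depth] at hT
  | succ D ih =>
    have h : {c : Fin m → PTree m | ∀ j, c j ∈ {T : PTree m | T.depth ≤ D}}.Finite :=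
      Set.Finite.pi' fun _ => ih
    refine ((h.image node).insert leaf).subset fun T hT => ?_
    cases T with
    | leaf => exact Or.inl rfl
    | node c =>
      refine Or.inr ⟨c, fun j => ?_, rfl⟩
      have h1 : (Finset.univ.sup fun j => (c j).depth) ≤ D := by
        simpa [depth] using hT
      exact (Finset.le_sup (f := fun j => (c j).depth) (Finset.mem_univ j)).trans h1

end PTree

/-- The model class of all proper `m`-ary trees of depth at most `D`. -/
noncomputable def modelClass (m D : ℕ) : Finset (PTree m) :=
  (PTree.finite_depth_le m D).toFinset

/-- Parameters `θ = {θ_s ; s ∈ T}`: one vector indexed by the alphabet for each leaf of `T`. -/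
abbrev Params {m : ℕ} (T : PTree m) : Type := T.leaves → Fin m → ℝ

/-- The symbols preceding position `N` in `x`, most recent first. -/
def pastAt {m : ℕ} (x : ℕ → Fin m) (N : ℕ) : ℕ → Fin m := fun k => x (N - 1 - k)

/- Throughout, a time series `x_{-D+1}, ..., x_0, x_1, ..., x_n` is stored from position `0` on:
position `k` holds `x_{k-D+1}`. Thus positions `0, ..., D-1` are the initial context and
`x_1, ..., x_n` sit at positions `D, ..., D+n-1`. Trees of depth at most `D` read only the `D`
positions before `N ≥ D`, so the truncated subtraction in `pastAt` is never reached. -/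

/-- The probability `P(x | T, θ)` of `x_1, ..., x_n` given the initial context. -/
def likelihood {m : ℕ} (D n : ℕ) (x : ℕ → Fin m) (T : PTree m) (θ : Params T) : ℝ :=
  ∏ i ∈ Finset.range n, θ (T.leafOf (pastAt x (D + i))) (x (D + i))

/-- The Dirichlet distribution with parameters `a`: the law of `(g_j / ∑ i, g_i)_j` for independent
`g_j` with Gamma distributions of shape `a j` and rate `1`. -/
noncomputable def dirichletMeasure {m : ℕ} (a : Fin m → ℝ) : Measure (Fin m → ℝ) :=
  (Measure.pi fun j => gammaMeasure (a j) 1).map fun g j => g j / ∑ i, g i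

/-- The prior `π(θ | T)`: independent `Dir(1/2, ..., 1/2)` vectors at the leaves of `T`. -/
noncomputable def paramPrior {m : ℕ} (T : PTree m) : Measure (Params T) :=
  Measure.pi fun _ : T.leaves => dirichletMeasure fun _ : Fin m => (1 / 2 : ℝ)

/-- The model prior `π_D(T; β) = α^(|T| - 1) β^(|T| - L_D(T))` with `α = (1 - β)^(1 / (m - 1))`. -/
noncomputable def modelPrior {m : ℕ} (D : ℕ) (β : ℝ) (T : PTree m) : ℝ :=
  ((1 - β) ^ (1 / ((m : ℝ) - 1))) ^ (T.leaves.card - 1) *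
    β ^ (T.leaves.card - (T.leaves.filter fun s => s.length = D).card)

/-- The marginal likelihood `P(x | T) = ∫ P(x | T, θ) π(θ | T) dθ`. -/
noncomputable def marginalLikelihood {m : ℕ} (D n : ℕ) (x : ℕ → Fin m) (T : PTree m) : ℝ :=
  ∫ θ, likelihood D n x T θ ∂(paramPrior T)

/-- The model posterior `π(T | x)` on `modelClass m D`, by Bayes' rule. -/
noncomputable def posterior {m : ℕ} (D : ℕ) (β : ℝ) (n : ℕ) (x : ℕ → Fin m) (T : PTree m) : ℝ :=
  modelPrior D β T * marginalLikelihood D n x T /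
    ∑ S ∈ modelClass m D, modelPrior D β S * marginalLikelihood D n x S

/-- `X` is a variable-memory Markov chain with model `T` (of depth at most `D`) and parameters `θ`;
the distribution of the initial context `X 0, ..., X (D - 1)` is arbitrary. -/
structure IsVariableMemoryChain {m : ℕ} (D : ℕ) (T : PTree m) (θ : Params T)
    {Ω : Type*} [MeasurableSpace Ω] (μ : Measure Ω) (X : ℕ → Ω → Fin m) : Prop where
  mem_modelClass : T ∈ modelClass m D
  nonneg : ∀ s j, 0 ≤ θ s j
  sum_eq_one : ∀ s, ∑ j, θ s j = 1
  measurable : ∀ k, Measurable (X k)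
  /-- Given the past, the next symbol has distribution `θ_s`, `s` the leaf of `T` that is a suffix
  of the past. -/
  transition : ∀ (N : ℕ), D ≤ N → ∀ w : ℕ → Fin m,
    μ.real {ω | ∀ k ≤ N, X k ω = w k} =
      μ.real {ω | ∀ k < N, X k ω = w k} * θ (T.leafOf (pastAt w N)) (w N)

/-- All parameters are nonzero. -/
def IsPositive {m : ℕ} {T : PTree m} (θ : Params T) : Prop := ∀ s j, θ s j ≠ 0

/-- A model is minimal if every `m`-tuple of sibling leaves contains two with different
parameters. -/
def IsMinimal {m : ℕ} (T : PTree m) (θ : Params T) : Prop :=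
  ∀ (s : List (Fin m)) (h : ∀ j, s ++ [j] ∈ T.leaves),
    ∃ j j', j ≠ j' ∧ θ ⟨s ++ [j], h j⟩ ≠ θ ⟨s ++ [j'], h j'⟩

end BCT

/-! A competitor `S ≠ T` in the class has a leaf above depth `D`. Below or at this leaf lies a full
set of sibling leaves of `T`, two of which carry different parameters by minimality. Whatever vector
`q` assigns to the leaf of `S`, it is Hellinger-far from one of the two (`sq_sum_sqrt_mul_le_or`).
By positivity, the chain reaches the corresponding context within `D` steps from any past, with
probability bounded below. Hence the affinity operator, with kernel `√(q θ)`, contracts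
geometrically, uniformly in `q` (`exists_iterate_affinity_le`).

Its iterates on `1` compute the mean of the square root of the likelihood ratio
(`integral_sqrtRatio`), so Markov's inequality and Borel–Cantelli make this ratio decay
exponentially, almost surely for each fixed `q`. No ergodic theorem is used.

To integrate over `q`, the marginal likelihood of `S` is bounded by a sum over finitely many `q`,
and that of `T` is bounded below by the likelihood at the true `θ`, each up to a factor `r ^ n` with
`r > 1` arbitrary (`exists_marginalLikelihood_le_sum`,
`exists_mul_likelihood_le_marginalLikelihood`). Summing the posterior odds over the finite class
gives the rate; the model prior affects only the constant in front. -/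

namespace BCT

/-! ### Paths in trees -/

namespace PTree

variable {m : ℕ}

theorem path_congr (T : PTree m) {p q : ℕ → Fin m} (h : ∀ k < (T.path p).length, p k = q k) :
    T.path p = T.path q := by
  induction T generalizing p q with
  | leaf => rfl
  | node c ih =>
    have h0 : p 0 = q 0 := h 0 (by simp [path])
    simp only [path]
    rw [← h0]
    congr 1
    exact ih _ fun k hk => h (k + 1) (by simpa [path] using hk)

theorem path_complete (D : ℕ) (p : ℕ → Fin m) :
    (complete m D).path p = (List.range D).map p := by
  induction D generalizing p with
  | zero => rfl
  | succ D ih =>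
    simp only [complete, path, ih, List.range_succ_eq_map, List.map_cons, List.map_map]
    rfl

/-- A tree of depth at most `D` all of whose paths have length `D` is complete. -/
theorem eq_complete_of_le_length_path {D : ℕ} {S : PTree m} (hS : S.depth ≤ D)
    (p₀ : ℕ → Fin m) (h : ∀ p, D ≤ (S.path p).length) : S = complete m D := by
  induction S generalizing D with
  | leaf =>
    -- The past `p₀` is needed here: over an empty alphabet `h` would be vacuous.
    have : D = 0 := by simpa [path] using h p₀
    subst this
    rfl
  | node c ih =>
    cases D with
    | zero => simp [depth] at hS
    | succ D =>
      simp only [complete, node.injEq]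
      funext j
      refine ih j ?_ fun p => ?_
      · have h1 : (Finset.univ.sup fun j => (c j).depth) ≤ D := by simpa [depth] using hS
        exact (Finset.le_sup (f := fun j => (c j).depth) (Finset.mem_univ j)).trans h1
      · simpa [path] using h fun k => Nat.casesOn k j p

end PTree

/-! ### Pasts and transfer operators -/

variable {m : ℕ}

/-- Prepend a symbol to a past. -/
def pastCons (j : Fin m) (p : ℕ → Fin m) : ℕ → Fin m
  | 0 => j
  | k + 1 => p k

theorem pastAt_succ (x : ℕ → Fin m) (N : ℕ) :
    pastAt x (N + 1) = pastCons (x N) (pastAt x N) := by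
  funext k
  cases k with
  | zero => rfl
  | succ k => exact congrArg x (by omega)

/-- Truncated subtraction sends the far past to position `0`, which lies below `N` only when `1 ≤
N`. -/
theorem pastAt_congr {x y : ℕ → Fin m} {N : ℕ} (hN : 1 ≤ N) (h : ∀ k < N, x k = y k) :
    pastAt x N = pastAt y N :=
  funext fun k => h _ (by omega)

/-- The operator averaging a function of the past over the next symbol with weights `a`. -/
def transferOp (a : (ℕ → Fin m) → Fin m → ℝ) (f : (ℕ → Fin m) → ℝ) : (ℕ → Fin m) → ℝ :=
  fun p => ∑ j, a p j * f (pastCons j p)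

section transferOp

variable {a q : (ℕ → Fin m) → Fin m → ℝ}

theorem transferOp_mono (ha : ∀ p j, 0 ≤ a p j) : Monotone (transferOp a) :=
  fun _ _ h p => Finset.sum_le_sum fun j _ => mul_le_mul_of_nonneg_left (h _) (ha p j)

theorem transferOp_nonneg (ha : ∀ p j, 0 ≤ a p j) {f : (ℕ → Fin m) → ℝ} (hf : ∀ p, 0 ≤ f p)
    (p : ℕ → Fin m) : 0 ≤ transferOp a f p :=
  Finset.sum_nonneg fun j _ => mul_nonneg (ha p j) (hf _)

theorem iterate_transferOp_nonneg (ha : ∀ p j, 0 ≤ a p j) {f : (ℕ → Fin m) → ℝ}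
    (hf : ∀ p, 0 ≤ f p) (n : ℕ) (p : ℕ → Fin m) : 0 ≤ (transferOp a)^[n] f p := by
  induction n generalizing p with
  | zero => exact hf p
  | succ n ih =>
    rw [Function.iterate_succ_apply']
    exact transferOp_nonneg ha ih p

theorem transferOp_const_mul (r : ℝ) (f : (ℕ → Fin m) → ℝ) :
    transferOp a (fun p => r * f p) = fun p => r * transferOp a f p := by
  funext p
  simp only [transferOp, Finset.mul_sum]
  exact Finset.sum_congr rfl fun j _ => by ring

theorem iterate_transferOp_const_mul (r : ℝ) (f : (ℕ → Fin m) → ℝ) (n : ℕ) :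
    (transferOp a)^[n] (fun p => r * f p) = fun p => r * (transferOp a)^[n] f p := by
  induction n with
  | zero => rfl
  | succ n ih => rw [Function.iterate_succ_apply', Function.iterate_succ_apply', ih,
      transferOp_const_mul]

theorem iterate_transferOp_one_le_one (ha : ∀ p j, 0 ≤ a p j)
    (h1 : ∀ p, transferOp a (fun _ => 1) p ≤ 1) (n : ℕ) (p : ℕ → Fin m) :
    (transferOp a)^[n] (fun _ => 1) p ≤ 1 := by
  induction n generalizing p with
  | zero => exact le_rfl
  | succ n ih =>
    rw [Function.iterate_succ_apply']
    exact (transferOp_mono ha (fun p => ih p) p).trans (h1 p)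

/-- If `r` steps contract by `ρ`, then `n` steps contract by `ρ ^ (n / r)`. -/
theorem iterate_transferOp_one_le_pow (ha : ∀ p j, 0 ≤ a p j)
    (h1 : ∀ p, transferOp a (fun _ => 1) p ≤ 1) {r : ℕ} (hr : 0 < r) {ρ : ℝ} (hρ : 0 ≤ ρ)
    (h : ∀ p, (transferOp a)^[r] (fun _ => 1) p ≤ ρ) (n : ℕ) (p : ℕ → Fin m) :
    (transferOp a)^[n] (fun _ => 1) p ≤ ρ ^ (n / r) := by
  induction n using Nat.strong_induction_on generalizing p with
  | _ n ih =>
    by_cases hn : n < r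
    · rw [Nat.div_eq_of_lt hn, pow_zero]
      exact iterate_transferOp_one_le_one ha h1 n p
    · obtain ⟨k, rfl⟩ := Nat.exists_eq_add_of_le (not_lt.1 hn)
      rw [Nat.add_div_left _ hr, pow_succ', add_comm, Function.iterate_add_apply]
      calc (transferOp a)^[k] ((transferOp a)^[r] fun _ => 1) p
          ≤ (transferOp a)^[k] (fun _ => ρ * 1) p :=
            (transferOp_mono ha).iterate k (fun p => by simpa using h p) p
        _ = ρ * (transferOp a)^[k] (fun _ => 1) p := by
            rw [iterate_transferOp_const_mul ρ (fun _ => 1)]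
        _ ≤ ρ * ρ ^ (k / r) := mul_le_mul_of_nonneg_left (ih k (by omega) p) hρ

/-- If `F ≤ 1` and `F` is smaller by `κ` at the pasts whose first `D` symbols are those of `t`, then
its `k`-step average is smaller than `1` by at least `κ δ ^ k` from every past from which these
pasts can be reached in `k` steps. -/
theorem iterate_transferOp_le_of_hitting {δ κ : ℝ} (hδ : 0 ≤ δ) (hκ : 0 ≤ κ)
    (ha : ∀ p j, δ ≤ a p j) (hsum : ∀ p, ∑ j, a p j = 1) {F : (ℕ → Fin m) → ℝ}
    (hF : ∀ p, F p ≤ 1) {D : ℕ} {t : ℕ → Fin m}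
    (ht : ∀ p, (∀ i < D, p i = t i) → F p ≤ 1 - κ) (k : ℕ) (p : ℕ → Fin m)
    (hp : ∀ i, i + k < D → p i = t (i + k)) :
    (transferOp a)^[k] F p ≤ 1 - κ * δ ^ k := by
  have ha0 : ∀ p j, 0 ≤ a p j := fun p j => hδ.trans (ha p j)
  have hle : ∀ k p, (transferOp a)^[k] F p ≤ 1 := by
    intro k
    induction k with
    | zero => exact hF
    | succ k ih =>
      intro p
      rw [Function.iterate_succ_apply']
      refine (transferOp_mono ha0 (fun p => ih p) p).trans ?_
      simp [transferOp, hsum p]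
  induction k generalizing p with
  | zero => simpa using ht p hp
  | succ k ih =>
    rw [Function.iterate_succ_apply']
    have hκδ : 0 ≤ κ * δ ^ k := by positivity
    -- The word `t` is laid down oldest symbol first: with `k + 1` steps left the symbol to append
    -- is `t k`, of weight at least `δ`. Every other symbol is given the trivial bound `1`.
    calc transferOp a ((transferOp a)^[k] F) p
        ≤ ∑ j, a p j * (1 - if j = t k then κ * δ ^ k else 0) := by
          refine Finset.sum_le_sum fun j _ => mul_le_mul_of_nonneg_left ?_ (ha0 p j)
          split_ifs with hj
          · refine ih _ fun i hi => ?_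
            cases i with
            | zero => simpa [pastCons] using hj
            | succ i =>
              have := hp i (by omega)
              rw [show i + 1 + k = i + (k + 1) by ring]
              exact this
          · simpa using hle k _
      _ = 1 - a p (t k) * (κ * δ ^ k) := by
          simp [mul_sub, Finset.sum_sub_distrib, hsum p]
      _ ≤ 1 - κ * δ ^ (k + 1) := by
          have := mul_le_mul_of_nonneg_right (ha p (t k)) hκδ
          rw [pow_succ]
          linarith

theorem sq_transferOp_sqrt_le (hq : ∀ p j, 0 ≤ q p j) (hq1 : ∀ p, ∑ j, q p j ≤ 1)
    (ha : ∀ p j, 0 ≤ a p j) (f : (ℕ → Fin m) → ℝ) (p : ℕ → Fin m) :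
    transferOp (fun p j => √(q p j * a p j)) f p ^ 2 ≤ transferOp a (fun p => f p ^ 2) p := by
  have h := Finset.sum_mul_sq_le_sq_mul_sq Finset.univ (fun j => √(q p j))
    (fun j => √(a p j) * f (pastCons j p))
  simp only [mul_pow, Real.sq_sqrt (hq p _), Real.sq_sqrt (ha p _)] at h
  calc transferOp (fun p j => √(q p j * a p j)) f p ^ 2
      = (∑ j, √(q p j) * (√(a p j) * f (pastCons j p))) ^ 2 := by
        simp only [transferOp, Real.sqrt_mul (hq p _), mul_assoc]
    _ ≤ (∑ j, q p j) * ∑ j, a p j * f (pastCons j p) ^ 2 := h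
    _ ≤ 1 * ∑ j, a p j * f (pastCons j p) ^ 2 :=
        mul_le_mul_of_nonneg_right (hq1 p)
          (Finset.sum_nonneg fun j _ => mul_nonneg (ha p j) (sq_nonneg _))
    _ = _ := one_mul _

/-- Cauchy–Schwarz at each step trades the kernel `√(q a)` for `a`. In the application `a` is the
true transition kernel, whose hitting probabilities do not involve `q`. -/
theorem sq_iterate_transferOp_sqrt_le (hq : ∀ p j, 0 ≤ q p j) (hq1 : ∀ p, ∑ j, q p j ≤ 1)
    (ha : ∀ p j, 0 ≤ a p j) (f : (ℕ → Fin m) → ℝ) (k : ℕ) (p : ℕ → Fin m) :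
    (transferOp fun p j => √(q p j * a p j))^[k] f p ^ 2 ≤
      (transferOp a)^[k] (fun p => f p ^ 2) p := by
  induction k generalizing p with
  | zero => exact le_rfl
  | succ k ih =>
    rw [Function.iterate_succ_apply', Function.iterate_succ_apply']
    exact (sq_transferOp_sqrt_le hq hq1 ha _ p).trans (transferOp_mono ha (fun p => ih p) p)

end transferOp

/-! ### Hellinger separation -/

section Hellinger

variable {ι : Type*} [Fintype ι]

/-- The squared Hellinger distance, without the factor `1 / 2`. -/
noncomputable def sqHellinger (a b : ι → ℝ) : ℝ := ∑ j, (√(a j) - √(b j)) ^ 2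

/-- Expand the squares in the distance; mass missing from `q` only helps. -/
theorem sum_sqrt_mul_le {q a : ι → ℝ} (hq : ∀ j, 0 ≤ q j) (ha : ∀ j, 0 ≤ a j)
    (hq1 : ∑ j, q j ≤ 1) (ha1 : ∑ j, a j = 1) :
    ∑ j, √(q j * a j) ≤ 1 - sqHellinger q a / 2 := by
  have h : sqHellinger q a = ∑ j, q j + ∑ j, a j - 2 * ∑ j, √(q j * a j) := by
    rw [sqHellinger, Finset.mul_sum, ← Finset.sum_add_distrib, ← Finset.sum_sub_distrib]
    refine Finset.sum_congr rfl fun j _ => ?_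
    rw [Real.sqrt_mul (hq j), sub_sq, Real.sq_sqrt (hq j), Real.sq_sqrt (ha j)]
    ring
  linarith

theorem sqHellinger_le_two_mul_add (q a b : ι → ℝ) :
    sqHellinger a b ≤ 2 * (sqHellinger q a + sqHellinger q b) := by
  simp only [sqHellinger]
  rw [← Finset.sum_add_distrib, Finset.mul_sum]
  refine Finset.sum_le_sum fun j _ => ?_
  nlinarith [sq_nonneg ((√(q j) - √(a j)) + (√(q j) - √(b j)))]

theorem sqHellinger_pos {a b : ι → ℝ} (ha : ∀ j, 0 ≤ a j) (hb : ∀ j, 0 ≤ b j) (h : a ≠ b) :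
    0 < sqHellinger a b := by
  obtain ⟨j, hj⟩ := Function.ne_iff.1 h
  refine Finset.sum_pos' (fun j _ => sq_nonneg _) ⟨j, Finset.mem_univ j, ?_⟩
  exact sq_pos_of_ne_zero (sub_ne_zero.2 fun h => hj ((Real.sqrt_inj (ha j) (hb j)).1 h))

/-- No subprobability vector is close to both of two different probability vectors. -/
theorem sq_sum_sqrt_mul_le_or {q a b : ι → ℝ} (hq : ∀ j, 0 ≤ q j) (ha : ∀ j, 0 ≤ a j)
    (hb : ∀ j, 0 ≤ b j) (hq1 : ∑ j, q j ≤ 1) (ha1 : ∑ j, a j = 1) (hb1 : ∑ j, b j = 1) :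
    (∑ j, √(q j * a j)) ^ 2 ≤ 1 - sqHellinger a b / 8 ∨
      (∑ j, √(q j * b j)) ^ 2 ≤ 1 - sqHellinger a b / 8 := by
  have h := sqHellinger_le_two_mul_add q a b
  have h0 : ∀ a b : ι → ℝ, 0 ≤ sqHellinger a b := fun a b =>
    Finset.sum_nonneg fun j _ => sq_nonneg _
  have key : ∀ c : ι → ℝ, (∀ j, 0 ≤ c j) → ∑ j, c j = 1 →
      sqHellinger a b / 4 ≤ sqHellinger q c →
      (∑ j, √(q j * c j)) ^ 2 ≤ 1 - sqHellinger a b / 8 := by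
    intro c hc hc1 hle
    have h1 := sum_sqrt_mul_le hq hc hq1 hc1
    have h2 : 0 ≤ ∑ j, √(q j * c j) := Finset.sum_nonneg fun j _ => Real.sqrt_nonneg _
    nlinarith [h0 a b, h0 q c]
  -- By the weak triangle inequality `h`, the distances from `q` to `a` and to `b` cannot both be
  -- below a quarter of that from `a` to `b`.
  by_cases h1 : sqHellinger a b / 4 ≤ sqHellinger q a
  · exact Or.inl (key a ha ha1 h1)
  · exact Or.inr (key b hb hb1 (by linarith))

end Hellinger

/-! ### Contraction of the affinity operator -/

theorem exists_pos_forall_le {ι κ : Type*} [Finite ι] [Finite κ] {f : ι → κ → ℝ}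
    (hf : ∀ i j, 0 < f i j) : ∃ δ : ℝ, 0 < δ ∧ ∀ i j, δ ≤ f i j := by
  rcases isEmpty_or_nonempty (ι × κ) with h | h
  · exact ⟨1, one_pos, fun i j => (h.false (i, j)).elim⟩
  · obtain ⟨x, hx⟩ := Finite.exists_min fun x : ι × κ => f x.1 x.2
    exact ⟨f x.1 x.2, hf _ _, fun i j => hx (i, j)⟩

theorem path_complete_eq_append {D : ℕ} {p₀ p : ℕ → Fin m} {j : Fin m}
    (h : ∀ i < D + 1, p i = Function.update p₀ D j i) :
    (PTree.complete m (D + 1)).path p = (List.range D).map p₀ ++ [j] := by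
  rw [PTree.path_complete, List.range_succ, List.map_append]
  congr 1
  · refine List.map_congr_left fun i hi => ?_
    have hi : i < D := by simpa using hi
    rw [h i (by omega), Function.update_of_ne hi.ne]
  · simp [h D (by omega)]

/-- The affinity operator between a minimal chain whose model is the complete tree and the models
on any other tree contracts geometrically, uniformly in the parameters. -/
theorem exists_iterate_affinity_le {D : ℕ} {T : PTree m} (hT : T = PTree.complete m D)
    {θ : Params T}
    (hpos : ∀ s j, 0 < θ s j) (hsum : ∀ s, ∑ j, θ s j = 1) (hmin : IsMinimal T θ)
    {S : PTree m} (hS : S.depth ≤ D) (hne : S ≠ T) (x₀ : Fin m) :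
    ∃ ρ : ℝ, 0 ≤ ρ ∧ ρ < 1 ∧ ∀ q : Params S, (∀ s j, 0 ≤ q s j) → (∀ s, ∑ j, q s j ≤ 1) →
      ∀ n p, (transferOp fun p j =>
        √(q (S.leafOf p) j * θ (T.leafOf p) j))^[n] (fun _ => 1) p ≤
          ρ ^ (n / (D + 1)) := by
  obtain ⟨p₀, hp₀⟩ : ∃ p, (S.path p).length < D := by
    by_contra! h
    exact hne (hT ▸ PTree.eq_complete_of_le_length_path hS (fun _ => x₀) h)
  obtain ⟨D, rfl⟩ : ∃ E, D = E + 1 := ⟨D - 1, by omega⟩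
  obtain ⟨δ, hδ, hδθ⟩ := exists_pos_forall_le hpos
  have hmem : ∀ j, (List.range D).map p₀ ++ [j] ∈ T.leaves := fun j => by
    rw [← path_complete_eq_append (p := Function.update p₀ D j) fun _ _ => rfl, ← hT]
    exact T.path_mem_leaves _
  obtain ⟨j, j', -, hjj⟩ := hmin _ hmem
  set a := θ ⟨_, hmem j⟩
  set b := θ ⟨_, hmem j'⟩
  have hH : 0 < sqHellinger a b := sqHellinger_pos (fun _ => (hpos _ _).le)
    (fun _ => (hpos _ _).le) hjj
  have hgap : 0 < sqHellinger a b / 8 * δ ^ (D + 1) := by positivity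
  -- The loss `sqHellinger a b / 8` is met with probability at least `δ ^ (D + 1)`; the root undoes
  -- the squaring in Cauchy–Schwarz.
  refine ⟨√(1 - sqHellinger a b / 8 * δ ^ (D + 1)), Real.sqrt_nonneg _, ?_, ?_⟩
  · rw [Real.sqrt_lt' one_pos]
    linarith
  intro q hq hq1 n p
  have hleafT : ∀ i p, (∀ k < D + 1, p k = Function.update p₀ D i k) →
      T.leafOf p = ⟨_, hmem i⟩ := fun i p h => Subtype.ext (hT ▸ path_complete_eq_append h)
  -- The leaf of `S` on `p₀` has length at most `D`, so `S` does not see the symbol at index `D`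
  -- that distinguishes the siblings.
  have hleafS : ∀ i p, (∀ k < D + 1, p k = Function.update p₀ D i k) →
      S.leafOf p = S.leafOf p₀ := fun i p h => by
    refine Subtype.ext (S.path_congr fun k hk => ?_).symm
    rw [h k (by omega), Function.update_of_ne (by omega)]
  have hq' : ∀ (p : ℕ → Fin m) j, 0 ≤ q (S.leafOf p) j := fun p j => hq _ _
  have hq1' : ∀ p : ℕ → Fin m, ∑ j, q (S.leafOf p) j ≤ 1 := fun p => hq1 _
  have hθ' : ∀ (p : ℕ → Fin m) j, 0 ≤ θ (T.leafOf p) j := fun p j => (hpos _ _).le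
  set L := transferOp fun p j => √(q (S.leafOf p) j * θ (T.leafOf p) j) with hL
  have hL1 : ∀ p, L (fun _ => 1) p = ∑ j, √(q (S.leafOf p) j * θ (T.leafOf p) j) := fun p => by
    simp [hL, transferOp]
  have hF : ∀ p, L (fun _ => 1) p ^ 2 ≤ 1 := fun p => by
    refine (sq_transferOp_sqrt_le hq' hq1' hθ' _ p).trans ?_
    simp [transferOp, hsum]
  -- The context `t` depends on `q`, but the size of the loss does not; this makes `ρ` uniform in
  -- `q`.
  obtain ⟨t, ht⟩ : ∃ t : ℕ → Fin m, ∀ p, (∀ i < D + 1, p i = t i) →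
      L (fun _ => 1) p ^ 2 ≤ 1 - sqHellinger a b / 8 := by
    rcases sq_sum_sqrt_mul_le_or (hq (S.leafOf p₀)) (fun i => (hpos ⟨_, hmem j⟩ i).le)
      (fun i => (hpos ⟨_, hmem j'⟩ i).le) (hq1 _) (hsum _) (hsum _) with h | h
    · refine ⟨Function.update p₀ D j, fun p hp => ?_⟩
      rw [hL1, hleafT j p hp, hleafS j p hp]
      exact h
    · refine ⟨Function.update p₀ D j', fun p hp => ?_⟩
      rw [hL1, hleafT j' p hp, hleafS j' p hp]
      exact h
  refine iterate_transferOp_one_le_pow (fun _ _ => Real.sqrt_nonneg _)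
    (fun p => (abs_le_one_iff_mul_self_le_one.2 (by simpa [sq] using hF p)) |> le_of_abs_le)
    (Nat.succ_pos _) (Real.sqrt_nonneg _) (fun p => ?_) n p
  refine Real.le_sqrt_of_sq_le ?_
  -- The innermost `L` incurs the loss; the `D + 1` others become steps of the true chain, enough to
  -- reach `t` from any past.
  rw [Function.iterate_succ_apply]
  refine (sq_iterate_transferOp_sqrt_le hq' hq1' hθ' _ _ p).trans ?_
  exact iterate_transferOp_le_of_hitting (a := fun p j => θ (T.leafOf p) j) hδ.le
    (by positivity) (fun p j => hδθ _ _) (fun p => hsum _) hF ht (D + 1) p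
    fun i hi => by omega

/-! ### Expectations along the chain -/

section Chain

variable {Ω : Type*} {X : ℕ → Ω → Fin m}

/-- A function of sequences that only depends on the first `N` terms is, along a process, a finite
combination of indicators. -/
theorem indicator_cylinder_eq_sum (x₀ : Fin m) {N : ℕ} {Φ : (ℕ → Fin m) → ℝ}
    (hΦ : ∀ x y : ℕ → Fin m, (∀ k < N, x k = y k) → Φ x = Φ y) (B : Set Ω) (ω : Ω) :
    B.indicator (fun ω => Φ fun k => X k ω) ω =
      ∑ w : Fin N → Fin m, ({ω | ∀ k < N, X k ω = if h : k < N then w ⟨k, h⟩ else x₀} ∩ B).indicator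
        (fun _ => Φ fun k => if h : k < N then w ⟨k, h⟩ else x₀) ω := by
  rw [Finset.sum_eq_single fun k : Fin N => X k ω]
  · by_cases hB : ω ∈ B
    · rw [Set.indicator_of_mem hB, Set.indicator_of_mem]
      · exact hΦ _ _ fun k hk => by simp [hk]
      · exact ⟨fun k hk => by simp [hk], hB⟩
    · rw [Set.indicator_of_notMem hB, Set.indicator_of_notMem fun h => hB h.2]
  · intro w _ hw
    refine Set.indicator_of_notMem (fun h => hw ?_) _
    funext k
    simpa using (h.1 k k.2).symm
  · exact fun h => absurd (Finset.mem_univ _) h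

variable [MeasurableSpace Ω] {μ : Measure Ω}

theorem measurableSet_forall_lt_eq (hX : ∀ k, Measurable (X k)) (N : ℕ) (w : ℕ → Fin m) :
    MeasurableSet {ω | ∀ k < N, X k ω = w k} := by
  simp only [Set.ofPred_forall]
  exact MeasurableSet.iInter fun k => MeasurableSet.iInter fun _ =>
    hX k (measurableSet_singleton (w k))

variable [IsProbabilityMeasure μ]

theorem integrable_indicator_cylinder (hX : ∀ k, Measurable (X k)) (x₀ : Fin m) {N : ℕ}
    {Φ : (ℕ → Fin m) → ℝ} (hΦ : ∀ x y : ℕ → Fin m, (∀ k < N, x k = y k) → Φ x = Φ y)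
    {B : Set Ω} (hB : MeasurableSet B) :
    Integrable (B.indicator fun ω => Φ fun k => X k ω) μ := by
  rw [funext (indicator_cylinder_eq_sum x₀ hΦ B)]
  exact integrable_finsetSum _ fun w _ =>
    (integrable_const _).indicator ((measurableSet_forall_lt_eq hX N _).inter hB)

theorem integral_indicator_cylinder (hX : ∀ k, Measurable (X k)) (x₀ : Fin m) {N : ℕ}
    {Φ : (ℕ → Fin m) → ℝ} (hΦ : ∀ x y : ℕ → Fin m, (∀ k < N, x k = y k) → Φ x = Φ y)
    {B : Set Ω} (hB : MeasurableSet B) :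
    ∫ ω, B.indicator (fun ω => Φ fun k => X k ω) ω ∂μ =
      ∑ w : Fin N → Fin m,
        μ.real ({ω | ∀ k < N, X k ω = if h : k < N then w ⟨k, h⟩ else x₀} ∩ B) *
          Φ fun k => if h : k < N then w ⟨k, h⟩ else x₀ := by
  have hm : ∀ w : Fin N → Fin m,
      MeasurableSet ({ω | ∀ k < N, X k ω = if h : k < N then w ⟨k, h⟩ else x₀} ∩ B) :=
    fun w => (measurableSet_forall_lt_eq hX N fun k => if h : k < N then w ⟨k, h⟩ else x₀).inter hB
  simp only [indicator_cylinder_eq_sum x₀ hΦ B]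
  rw [integral_finsetSum _ fun w _ => (integrable_const _).indicator (hm w)]
  exact Finset.sum_congr rfl fun w _ => by rw [integral_indicator_const _ (hm w), smul_eq_mul]

theorem integrable_cylinder (hX : ∀ k, Measurable (X k)) (x₀ : Fin m) {N : ℕ}
    {Φ : (ℕ → Fin m) → ℝ} (hΦ : ∀ x y : ℕ → Fin m, (∀ k < N, x k = y k) → Φ x = Φ y) :
    Integrable (fun ω => Φ fun k => X k ω) μ := by
  simpa using integrable_indicator_cylinder hX x₀ hΦ (MeasurableSet.univ (α := Ω))

/-- The conditional distribution of the next symbol, integrated against a function of the past. -/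
theorem IsVariableMemoryChain.integral_indicator {D : ℕ} {T : PTree m} {θ : Params T}
    (h : IsVariableMemoryChain D T θ μ X) (x₀ : Fin m) {N : ℕ} (hN : 1 ≤ N) (hD : D ≤ N)
    {Φ : (ℕ → Fin m) → ℝ} (hΦ : ∀ x y : ℕ → Fin m, (∀ k < N, x k = y k) → Φ x = Φ y)
    (j : Fin m) :
    ∫ ω, (X N ⁻¹' {j}).indicator (fun ω => Φ fun k => X k ω) ω ∂μ =
      ∫ ω, Φ (fun k => X k ω) * θ (T.leafOf (pastAt (fun k => X k ω) N)) j ∂μ := by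
  have hΨ : ∀ x y : ℕ → Fin m, (∀ k < N, x k = y k) →
      Φ x * θ (T.leafOf (pastAt x N)) j = Φ y * θ (T.leafOf (pastAt y N)) j := fun x y hxy => by
    rw [hΦ x y hxy, pastAt_congr hN hxy]
  have hR := integral_indicator_cylinder (μ := μ) h.measurable x₀ hΨ MeasurableSet.univ
  simp only [Set.indicator_univ, Set.inter_univ] at hR
  rw [hR, integral_indicator_cylinder h.measurable x₀ hΦ
    (h.measurable N (measurableSet_singleton j))]
  refine Finset.sum_congr rfl fun w _ => ?_
  set v : ℕ → Fin m := fun k => if h : k < N then w ⟨k, h⟩ else x₀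
  have hv : ∀ k < N, Function.update v N j k = v k := fun k hk => Function.update_of_ne hk.ne _ _
  have ht := h.transition N hD (Function.update v N j)
  rw [Function.update_self, pastAt_congr hN hv] at ht
  have h1 : {ω | ∀ k ≤ N, X k ω = Function.update v N j k} =
      {ω | ∀ k < N, X k ω = v k} ∩ X N ⁻¹' {j} := by
    ext ω
    constructor
    · intro hω
      exact ⟨fun k hk => (hω k hk.le).trans (hv k hk), by simpa using hω N le_rfl⟩
    · rintro ⟨h1, h2⟩ k hk
      rcases hk.lt_or_eq with hk | rfl
      · exact (h1 k hk).trans (hv k hk).symm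
      · simpa using h2
  have h2 : {ω | ∀ k < N, X k ω = Function.update v N j k} = {ω | ∀ k < N, X k ω = v k} := by
    ext ω
    exact forall₂_congr fun k hk => by rw [hv k hk]
  rw [h1, h2] at ht
  rw [ht]
  ring

/-- The square root of the likelihood ratio of the model `q` on `S` and the model `θ` on `T`. -/
noncomputable def sqrtRatio (D n : ℕ) (x : ℕ → Fin m) {S T : PTree m} (q : Params S)
    (θ : Params T) : ℝ :=
  ∏ i ∈ Finset.range n, √(q (S.leafOf (pastAt x (D + i))) (x (D + i)) /
    θ (T.leafOf (pastAt x (D + i))) (x (D + i)))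

theorem sqrtRatio_congr {D n : ℕ} (hD : 1 ≤ D) {x y : ℕ → Fin m} {S T : PTree m} (q : Params S)
    (θ : Params T) (h : ∀ k < D + n, x k = y k) :
    sqrtRatio D n x q θ = sqrtRatio D n y q θ := by
  refine Finset.prod_congr rfl fun i hi => ?_
  have hi : i < n := by simpa using hi
  rw [pastAt_congr (N := D + i) (by omega) fun k hk => h k (by omega), h (D + i) (by omega)]

/-- Conditioning on the past turns the factor `√(q / θ)` of the last symbol into `√(q / θ) * θ = √(q
θ)`, the kernel of the operator. The test function `g` is kept arbitrary so that the induction can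
absorb this step into it. -/
theorem IsVariableMemoryChain.integral_sqrtRatio {D : ℕ} (hD : 1 ≤ D) {T S : PTree m}
    {θ : Params T} (h : IsVariableMemoryChain D T θ μ X) (hpos : ∀ s j, 0 < θ s j) {q : Params S}
    (hq : ∀ s j, 0 ≤ q s j) (x₀ : Fin m) (n : ℕ) (g : (ℕ → Fin m) → ℝ) :
    ∫ ω, sqrtRatio D n (fun k => X k ω) q θ * g (pastAt (fun k => X k ω) (D + n)) ∂μ =
      ∫ ω, (transferOp fun p j => √(q (S.leafOf p) j * θ (T.leafOf p) j))^[n] g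
        (pastAt (fun k => X k ω) D) ∂μ := by
  induction n generalizing g with
  | zero => simp [sqrtRatio]
  | succ n ih =>
    rw [Function.iterate_succ_apply, ← ih]
    set r : (ℕ → Fin m) → Fin m → ℝ := fun p j => √(q (S.leafOf p) j / θ (T.leafOf p) j) with hr
    set Φ : Fin m → (ℕ → Fin m) → ℝ := fun j x => sqrtRatio D n x q θ *
      r (pastAt x (D + n)) j * g (pastCons j (pastAt x (D + n))) with hΦdef
    have hΦ : ∀ j, ∀ x y : ℕ → Fin m, (∀ k < D + n, x k = y k) → Φ j x = Φ j y :=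
      fun j x y hxy => by
        simp only [hΦdef]
        rw [sqrtRatio_congr hD q θ hxy, pastAt_congr (by omega) hxy]
    have hΨ : ∀ j, ∀ x y : ℕ → Fin m, (∀ k < D + n, x k = y k) →
        Φ j x * θ (T.leafOf (pastAt x (D + n))) j = Φ j y * θ (T.leafOf (pastAt y (D + n))) j :=
      fun j x y hxy => by rw [hΦ j x y hxy, pastAt_congr (by omega) hxy]
    have hL : ∀ ω, sqrtRatio D (n + 1) (fun k => X k ω) q θ *
        g (pastAt (fun k => X k ω) (D + (n + 1))) =
          ∑ j, (X (D + n) ⁻¹' {j}).indicator (fun ω => Φ j fun k => X k ω) ω := fun ω => by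
      rw [Finset.sum_eq_single (X (D + n) ω)]
      · rw [Set.indicator_of_mem (by simp), ← add_assoc, pastAt_succ, sqrtRatio,
          Finset.prod_range_succ]
        rfl
      · intro j _ hj
        exact Set.indicator_of_notMem (fun h => hj h.symm) _
      · exact fun h => absurd (Finset.mem_univ _) h
    have hR : ∀ ω, sqrtRatio D n (fun k => X k ω) q θ *
        transferOp (fun p j => √(q (S.leafOf p) j * θ (T.leafOf p) j)) g
          (pastAt (fun k => X k ω) (D + n)) =
        ∑ j, Φ j (fun k => X k ω) * θ (T.leafOf (pastAt (fun k => X k ω) (D + n))) j := fun ω => by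
      rw [transferOp, Finset.mul_sum]
      refine Finset.sum_congr rfl fun j _ => ?_
      have key : ∀ a b : ℝ, 0 ≤ a → 0 < b → √(a * b) = √(a / b) * b := fun a b ha hb => by
        rw [Real.sqrt_div ha, Real.sqrt_mul ha, div_mul_eq_mul_div, eq_div_iff
          (Real.sqrt_ne_zero'.2 hb), mul_assoc, Real.mul_self_sqrt hb.le]
      rw [key _ _ (hq _ _) (hpos _ _)]
      simp only [hΦdef, hr]
      ring
    simp only [hL, hR]
    rw [integral_finsetSum _ fun j _ => integrable_indicator_cylinder h.measurable x₀ (hΦ j)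
        (h.measurable (D + n) (measurableSet_singleton j)),
      integral_finsetSum _ fun j _ => integrable_cylinder h.measurable x₀ (hΨ j)]
    exact Finset.sum_congr rfl fun j _ => h.integral_indicator x₀ (by omega) (by omega) (hΦ j) j

end Chain

/-! ### Almost sure decay of likelihood ratios -/

theorem exists_pow_div_le_exp {ρ : ℝ} (h0 : 0 ≤ ρ) (h1 : ρ < 1) {r : ℕ} (hr : 0 < r) :
    ∃ c C : ℝ, 0 < c ∧ ∀ n : ℕ, ρ ^ (n / r) ≤ C * Real.exp (-(2 * c) * n) := by
  -- The maximum keeps the logarithm meaningful when `ρ = 0`; the prefactor `σ⁻¹` pays for the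
  -- rounding in `n / r`.
  set σ := max ρ (1 / 2)
  have hσ0 : 0 < σ := lt_max_of_lt_right (by norm_num)
  have hσ1 : σ < 1 := max_lt h1 (by norm_num)
  have hlog : Real.log σ < 0 := Real.log_neg hσ0 hσ1
  have hr' : (0 : ℝ) < r := by exact_mod_cast hr
  refine ⟨-Real.log σ / (2 * r), σ⁻¹, by apply div_pos <;> linarith, fun n => ?_⟩
  have hn : (n : ℝ) / r ≤ (n / r : ℕ) + 1 := (Nat.lt_floor_add_one _).le.trans (by
    rw [Nat.floor_div_natCast, Nat.floor_natCast])
  calc ρ ^ (n / r) ≤ σ ^ (n / r) := pow_le_pow_left₀ h0 (le_max_left _ _) _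
    _ = σ⁻¹ * Real.exp (Real.log σ * ((n / r : ℕ) + 1)) := by
        rw [mul_add, Real.exp_add, mul_one, Real.exp_log hσ0, mul_comm (Real.log σ),
          Real.exp_nat_mul, Real.exp_log hσ0]
        field_simp
    _ ≤ σ⁻¹ * Real.exp (Real.log σ * (n / r)) := by
        refine mul_le_mul_of_nonneg_left (Real.exp_le_exp.2 ?_) (inv_nonneg.2 hσ0.le)
        exact mul_le_mul_of_nonpos_left hn hlog.le
    _ = _ := by
        congr 2
        field_simp

theorem likelihood_nonneg {D n : ℕ} {x : ℕ → Fin m} {S : PTree m} {q : Params S}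
    (hq : ∀ s j, 0 ≤ q s j) : 0 ≤ likelihood D n x S q :=
  Finset.prod_nonneg fun _ _ => hq _ _

theorem likelihood_pos {D n : ℕ} {x : ℕ → Fin m} {S : PTree m} {q : Params S}
    (hq : ∀ s j, 0 < q s j) : 0 < likelihood D n x S q :=
  Finset.prod_pos fun _ _ => hq _ _

theorem likelihood_le_pow_mul {D n : ℕ} {x : ℕ → Fin m} {S : PTree m} {q q' : Params S} {r : ℝ}
    (hq : ∀ s j, 0 ≤ q s j) (h : ∀ s j, q s j ≤ r * q' s j) :
    likelihood D n x S q ≤ r ^ n * likelihood D n x S q' := by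
  calc likelihood D n x S q
      ≤ ∏ i ∈ Finset.range n, r * q' (S.leafOf (pastAt x (D + i))) (x (D + i)) :=
        Finset.prod_le_prod (fun _ _ => hq _ _) fun _ _ => h _ _
    _ = r ^ n * likelihood D n x S q' := by
        rw [Finset.prod_mul_distrib, Finset.prod_const, Finset.card_range, likelihood]

theorem sqrtRatio_nonneg {D n : ℕ} {x : ℕ → Fin m} {S T : PTree m} (q : Params S) (θ : Params T) :
    0 ≤ sqrtRatio D n x q θ :=
  Finset.prod_nonneg fun _ _ => Real.sqrt_nonneg _

theorem likelihood_eq_sq_sqrtRatio_mul {D n : ℕ} {x : ℕ → Fin m} {S T : PTree m} {q : Params S}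
    {θ : Params T} (hq : ∀ s j, 0 ≤ q s j) (hθ : ∀ s j, 0 < θ s j) :
    likelihood D n x S q = sqrtRatio D n x q θ ^ 2 * likelihood D n x T θ := by
  rw [likelihood, likelihood, sqrtRatio, ← Finset.prod_pow, ← Finset.prod_mul_distrib]
  refine Finset.prod_congr rfl fun i _ => ?_
  rw [Real.sq_sqrt (div_nonneg (hq _ _) (hθ _ _).le), div_mul_cancel₀ _ (hθ _ _).ne']

/-- If the affinity operator decays exponentially, the likelihood ratio does so almost surely. -/
theorem IsVariableMemoryChain.ae_eventually_likelihood_le {Ω : Type*} [MeasurableSpace Ω]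
    {μ : Measure Ω} [IsProbabilityMeasure μ] {X : ℕ → Ω → Fin m} {D : ℕ} (hD : 1 ≤ D)
    {T S : PTree m} {θ : Params T} (h : IsVariableMemoryChain D T θ μ X)
    (hpos : ∀ s j, 0 < θ s j) {q : Params S} (hq : ∀ s j, 0 ≤ q s j) (x₀ : Fin m) {c C : ℝ}
    (hc : 0 < c)
    (hL : ∀ n p, (transferOp fun p j => √(q (S.leafOf p) j * θ (T.leafOf p) j))^[n]
      (fun _ => 1) p ≤ C * Real.exp (-(2 * c) * n)) :
    ∀ᵐ ω ∂μ, ∀ᶠ n : ℕ in atTop, likelihood D n (fun k => X k ω) S q ≤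
      Real.exp (-(2 * c) * n) * likelihood D n (fun k => X k ω) T θ := by
  set Z : ℕ → Ω → ℝ := fun n ω => sqrtRatio D n (fun k => X k ω) q θ
  have hint : ∀ n, ∫ ω, Z n ω ∂μ ≤ C * Real.exp (-(2 * c) * n) := fun n => by
    have := h.integral_sqrtRatio hD hpos hq x₀ n fun _ => 1
    simp only [mul_one] at this
    rw [this]
    calc _ ≤ ∫ _, C * Real.exp (-(2 * c) * n) ∂μ :=
          integral_mono_of_nonneg
            (ae_of_all _ fun ω => iterate_transferOp_nonneg (fun _ _ => Real.sqrt_nonneg _)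
              (fun _ => zero_le_one) n _)
            (integrable_const _) (ae_of_all _ fun ω => hL n _)
      _ = _ := by simp
  -- The threshold spends half of the rate `2 * c` on summability of the probabilities; squaring `Z`
  -- recovers it.
  have hmarkov : ∀ n : ℕ, μ.real {ω | Real.exp (-c * n) ≤ Z n ω} ≤ C * Real.exp (-c) ^ n :=
    fun n => by
    have h1 := mul_meas_ge_le_integral_of_nonneg (μ := μ) (f := Z n)
      (ae_of_all _ fun ω => sqrtRatio_nonneg q θ)
      (integrable_cylinder h.measurable x₀ fun x y hxy => sqrtRatio_congr hD q θ hxy)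
      (Real.exp (-c * n))
    have h2 := h1.trans (hint n)
    rw [show -(2 * c) * (n : ℝ) = -c * n + n * -c by ring, Real.exp_add, Real.exp_nat_mul,
      mul_left_comm] at h2
    exact le_of_mul_le_mul_left h2 (Real.exp_pos _)
  have hsum : Summable fun n : ℕ => μ.real {ω | Real.exp (-c * n) ≤ Z n ω} :=
    Summable.of_nonneg_of_le (fun _ => measureReal_nonneg) hmarkov
      ((summable_geometric_of_lt_one (Real.exp_pos _).le
        (Real.exp_lt_one_iff.2 (by linarith))).mul_left C)
  have hBC : ∑' n : ℕ, μ {ω | Real.exp (-c * n) ≤ Z n ω} ≠ ⊤ := by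
    have := hsum.tsum_ofReal_ne_top
    simp_rw [fun n : ℕ => ofReal_measureReal (μ := μ) (s := {ω | Real.exp (-c * n) ≤ Z n ω})] at this
    exact this
  filter_upwards [ae_eventually_notMem hBC] with ω hω
  filter_upwards [hω] with n hn
  have hn : Z n ω < Real.exp (-c * n) := not_le.1 hn
  rw [likelihood_eq_sq_sqrtRatio_mul hq hpos]
  refine mul_le_mul_of_nonneg_right ?_ (likelihood_pos hpos).le
  calc _ ≤ Real.exp (-c * n) ^ 2 := pow_le_pow_left₀ (sqrtRatio_nonneg q θ) hn.le 2
    _ = _ := by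
      rw [← Real.exp_nat_mul]
      congr 1
      push_cast
      ring

/-! ### The Dirichlet distribution -/

section Dirichlet

variable {a : Fin m → ℝ}

theorem measurable_div_sum : Measurable fun (g : Fin m → ℝ) j => g j / ∑ i, g i := by
  fun_prop

theorem isProbabilityMeasure_dirichletMeasure (ha : ∀ j, 0 < a j) :
    IsProbabilityMeasure (dirichletMeasure a) := by
  have := fun j => isProbabilityMeasure_gammaMeasure (ha j) one_pos
  exact Measure.isProbabilityMeasure_map measurable_div_sum.aemeasurable

theorem ae_nonneg_gammaMeasure (r s : ℝ) : ∀ᵐ x ∂gammaMeasure r s, 0 ≤ x := by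
  rw [ae_iff]
  have h : {x : ℝ | ¬0 ≤ x} = Set.Iio 0 := by ext; simp
  rw [h, gammaMeasure, withDensity_apply _ measurableSet_Iio]
  exact lintegral_gammaPDF_of_nonpos le_rfl

theorem gammaMeasure_Icc_pos {r s x y : ℝ} (hr : 0 < r) (hs : 0 < s) (hx : 0 < x) (hxy : x < y) :
    0 < gammaMeasure r s (Set.Icc x y) := by
  rw [gammaMeasure, withDensity_apply _ measurableSet_Icc, setLIntegral_pos_iff
    (show Measurable (gammaPDF r s) from (measurable_gammaPDFReal r s).ennreal_ofReal)]
  have h : Set.Icc x y ⊆ Function.support (gammaPDF r s) ∩ Set.Icc x y := fun z hz =>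
    ⟨(ENNReal.ofReal_pos.2 (gammaPDFReal_pos hr hs (hx.trans_le hz.1))).ne', hz⟩
  refine lt_of_lt_of_le ?_ (measure_mono h)
  simpa using hxy

/-- Asking only for `∑ j, v j ≤ 1` avoids the event that the gamma variables sum to `0`, where
division returns `0`; subprobability vectors suffice throughout. -/
theorem ae_dirichletMeasure (ha : ∀ j, 0 < a j) :
    ∀ᵐ v ∂dirichletMeasure a, (∀ j, 0 ≤ v j) ∧ ∑ j, v j ≤ 1 := by
  have := fun j => isProbabilityMeasure_gammaMeasure (ha j) one_pos
  have hset : MeasurableSet {v : Fin m → ℝ | (∀ j, 0 ≤ v j) ∧ ∑ j, v j ≤ 1} := by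
    measurability
  rw [dirichletMeasure, ae_map_iff measurable_div_sum.aemeasurable hset]
  have h : ∀ᵐ g ∂Measure.pi fun j => gammaMeasure (a j) 1, ∀ j, 0 ≤ g j :=
    eventually_all.2 fun j => Measure.tendsto_eval_ae_ae.eventually (ae_nonneg_gammaMeasure _ _)
  filter_upwards [h] with g hg
  refine ⟨fun j => div_nonneg (hg j) (Finset.sum_nonneg fun i _ => hg i), ?_⟩
  rw [← Finset.sum_div]
  exact div_self_le_one _

/-- The Dirichlet distribution charges the vectors that are coordinatewise at least a fraction of
a given positive probability vector. -/
theorem dirichletMeasure_pos (ha : ∀ j, 0 < a j) {v : Fin m → ℝ} (hv : ∀ j, 0 < v j)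
    (hv1 : ∑ j, v j = 1) {r : ℝ} (hr : 1 < r) :
    0 < dirichletMeasure a {u | ∀ j, v j ≤ r * u j} := by
  have := fun j => isProbabilityMeasure_gammaMeasure (ha j) one_pos
  have hset : MeasurableSet {u : Fin m → ℝ | ∀ j, v j ≤ r * u j} := by measurability
  rw [dirichletMeasure, Measure.map_apply measurable_div_sum hset]
  -- If each `g j` lies between `v j` and `r * v j`, the normalizing sum is at most `r`. This box
  -- has positive mass.
  have hsub : (Set.univ.pi fun j => Set.Icc (v j) (r * v j)) ⊆
      (fun (g : Fin m → ℝ) j => g j / ∑ i, g i) ⁻¹' {u | ∀ j, v j ≤ r * u j} := by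
    intro g hg j
    have hg' : ∀ j, v j ≤ g j ∧ g j ≤ r * v j := fun j => hg j (Set.mem_univ j)
    have h1 : ∑ i, g i ≤ r := by
      calc ∑ i, g i ≤ ∑ i, r * v i := Finset.sum_le_sum fun i _ => (hg' i).2
        _ = r := by rw [← Finset.mul_sum, hv1, mul_one]
    have h2 : 0 < ∑ i, g i := Finset.sum_pos (fun i _ => (hv i).trans_le (hg' i).1) ⟨j, by simp⟩
    change v j ≤ r * (g j / ∑ i, g i)
    rw [mul_div_assoc', le_div_iff₀ h2]
    have h3 := (hv j).trans_le (hg' j).1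
    nlinarith [(hg' j).1, hv j]
  refine lt_of_lt_of_le ?_ (measure_mono hsub)
  rw [Measure.pi_pi]
  refine CanonicallyOrderedAdd.prod_pos.2 fun j _ => gammaMeasure_Icc_pos (ha j) one_pos (hv j) ?_
  nlinarith [hv j]

end Dirichlet

/-! ### Bounds on marginal likelihoods -/

section Prior

variable (S : PTree m)

theorem isProbabilityMeasure_dirichletMeasure_half :
    IsProbabilityMeasure (dirichletMeasure fun _ : Fin m => (1 / 2 : ℝ)) :=
  isProbabilityMeasure_dirichletMeasure fun _ => by norm_num

instance isProbabilityMeasure_paramPrior : IsProbabilityMeasure (paramPrior S) := by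
  have := isProbabilityMeasure_dirichletMeasure_half (m := m)
  unfold paramPrior
  infer_instance

theorem ae_paramPrior :
    ∀ᵐ q ∂paramPrior S, (∀ s j, 0 ≤ q s j) ∧ ∀ s, ∑ j, q s j ≤ 1 := by
  have := isProbabilityMeasure_dirichletMeasure_half (m := m)
  have h : ∀ᵐ q ∂paramPrior S, ∀ s, (∀ j, 0 ≤ q s j) ∧ ∑ j, q s j ≤ 1 :=
    eventually_all.2 fun s => (Measure.tendsto_eval_ae_ae (i := s)
      (μ := fun _ : S.leaves => dirichletMeasure fun _ : Fin m => (1 / 2 : ℝ))).eventually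
        (ae_dirichletMeasure fun _ => by norm_num)
  filter_upwards [h] with q hq
  exact ⟨fun s => (hq s).1, fun s => (hq s).2⟩

variable {S}

theorem measurable_likelihood (D n : ℕ) (x : ℕ → Fin m) : Measurable (likelihood D n x S) := by
  unfold likelihood
  fun_prop

theorem integrable_likelihood (D n : ℕ) (x : ℕ → Fin m) :
    Integrable (likelihood D n x S) (paramPrior S) := by
  refine Integrable.of_bound (measurable_likelihood D n x).aestronglyMeasurable 1 ?_
  filter_upwards [ae_paramPrior S] with q hq
  rw [Real.norm_of_nonneg (likelihood_nonneg hq.1)]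
  exact Finset.prod_le_one (fun _ _ => hq.1 _ _) fun _ _ =>
    (Finset.single_le_sum (fun j _ => hq.1 _ j) (Finset.mem_univ _)).trans (hq.2 _)

theorem marginalLikelihood_nonneg (D n : ℕ) (x : ℕ → Fin m) :
    0 ≤ marginalLikelihood D n x S :=
  integral_nonneg_of_ae ((ae_paramPrior S).mono fun _ hq => likelihood_nonneg hq.1)

/-- Restrict the integral to the parameters `q` with `θ ≤ r * q` coordinatewise, where each factor
of the likelihood loses at most `r`; `b` is the prior mass of this set. -/
theorem exists_mul_likelihood_le_marginalLikelihood {θ : Params S} (hθ : ∀ s j, 0 < θ s j)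
    (hsum : ∀ s, ∑ j, θ s j = 1) {r : ℝ} (hr : 1 < r) :
    ∃ b : ℝ, 0 < b ∧ ∀ D n x,
      b * likelihood D n x S θ ≤ r ^ n * marginalLikelihood D n x S := by
  have := isProbabilityMeasure_dirichletMeasure_half (m := m)
  have hA : ∀ s, 0 < dirichletMeasure (fun _ : Fin m => (1 / 2 : ℝ)) {u | ∀ j, θ s j ≤ r * u j} :=
    fun s => dirichletMeasure_pos (fun _ => by norm_num) (hθ s) (hsum s) hr
  set U : Set (Params S) := Set.univ.pi fun s => {u | ∀ j, θ s j ≤ r * u j} with hUdef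
  have hU : MeasurableSet U := MeasurableSet.univ_pi fun s => by measurability
  have hpos : 0 < paramPrior S U := by
    rw [paramPrior, hUdef, Measure.pi_pi]
    exact CanonicallyOrderedAdd.prod_pos.2 fun s _ => hA s
  refine ⟨(paramPrior S).real U, ENNReal.toReal_pos hpos.ne' (measure_ne_top _ _),
    fun D n x => ?_⟩
  calc (paramPrior S).real U * likelihood D n x S θ
      = ∫ q, U.indicator (fun _ => likelihood D n x S θ) q ∂paramPrior S := by
        rw [integral_indicator_const _ hU, smul_eq_mul]
    _ ≤ ∫ q, r ^ n * likelihood D n x S q ∂paramPrior S := by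
        refine integral_mono_ae ((integrable_const _).indicator hU)
          ((integrable_likelihood D n x).const_mul _) ?_
        filter_upwards [ae_paramPrior S] with q hq
        refine Set.indicator_apply_le' (fun hqU => ?_) fun _ => ?_
        · exact likelihood_le_pow_mul (fun s j => (hθ s j).le) fun s j => hqU s (Set.mem_univ s) j
        · exact mul_nonneg (by positivity) (likelihood_nonneg hq.1)
    _ = r ^ n * marginalLikelihood D n x S := integral_const_mul _ _

/-- Every likelihood is dominated, up to an arbitrarily small exponential factor, by one of finitely
many, so that the marginal likelihood is dominated by their sum. -/
theorem exists_marginalLikelihood_le_sum (S : PTree m) {r : ℝ} (hr : 1 < r) :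
    ∃ Q : Finset (Params S), (∀ q ∈ Q, (∀ s j, 0 ≤ q s j) ∧ ∀ s, ∑ j, q s j ≤ 1) ∧
      ∀ D n x, marginalLikelihood D n x S ≤ r ^ n * ∑ q ∈ Q, likelihood D n x S q := by
  classical
  -- Rounding `K * q` up to integers adds at most `m` to the sum, so dividing by `K + m` gives a
  -- subprobability vector again. The cost per symbol is `(K + m) / K ≤ r`.
  obtain ⟨K, hK⟩ := exists_nat_gt (m / (r - 1) : ℝ)
  have hr1 : 0 < r - 1 := by linarith
  have hK0 : (0 : ℝ) < K := lt_of_le_of_lt (by positivity) hK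
  have hKr : (K : ℝ) + m ≤ r * K := by
    rw [div_lt_iff₀ hr1] at hK
    linarith
  have hKm : (0 : ℝ) < K + m := by positivity
  let f : (S.leaves → Fin m → Fin (K + 1)) → Params S := fun k s j => (k s j : ℝ) / (K + m)
  refine ⟨(Finset.univ.image f).filter fun q => ∀ s, ∑ j, q s j ≤ 1, ?_, ?_⟩
  · intro q hq
    simp only [Finset.mem_filter, Finset.mem_image, Finset.mem_univ, true_and] at hq
    obtain ⟨⟨k, rfl⟩, h⟩ := hq
    exact ⟨fun s j => by positivity, h⟩
  · intro D n x
    set Q := (Finset.univ.image f).filter fun q => ∀ s, ∑ j, q s j ≤ 1 with hQ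
    have key : ∀ᵐ q ∂paramPrior S,
        likelihood D n x S q ≤ r ^ n * ∑ q ∈ Q, likelihood D n x S q := by
      filter_upwards [ae_paramPrior S] with q hq
      have hq1 : ∀ s j, q s j ≤ 1 := fun s j =>
        (Finset.single_le_sum (fun j _ => hq.1 s j) (Finset.mem_univ j)).trans (hq.2 s)
      have hceil : ∀ s j, ⌈K * q s j⌉₊ < K + 1 := fun s j =>
        Nat.lt_succ_of_le (Nat.ceil_le.2 (by nlinarith [hq1 s j]))
      let k : S.leaves → Fin m → Fin (K + 1) := fun s j => ⟨⌈K * q s j⌉₊, hceil s j⟩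
      have hkQ : f k ∈ Q := by
        simp only [hQ, Finset.mem_filter, Finset.mem_image, Finset.mem_univ, true_and]
        refine ⟨⟨k, rfl⟩, fun s => ?_⟩
        simp only [f, k]
        rw [← Finset.sum_div, div_le_one hKm]
        calc ∑ j, (⌈K * q s j⌉₊ : ℝ) ≤ ∑ j, (K * q s j + 1) :=
              Finset.sum_le_sum fun j _ =>
                (Nat.ceil_lt_add_one (mul_nonneg hK0.le (hq.1 s j))).le
          _ = K * ∑ j, q s j + m := by simp [Finset.sum_add_distrib, Finset.mul_sum]
          _ ≤ K + m := by nlinarith [hq.2 s]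
      refine (likelihood_le_pow_mul (q' := f k) (r := r) hq.1 fun s j => ?_).trans ?_
      · have h1 : (K : ℝ) * q s j ≤ ⌈K * q s j⌉₊ := Nat.le_ceil _
        simp only [f, k]
        rw [mul_div_assoc', le_div_iff₀ hKm]
        nlinarith [mul_le_mul_of_nonneg_left hKr (hq.1 s j)]
      · refine mul_le_mul_of_nonneg_left ?_ (by positivity)
        refine Finset.single_le_sum (f := fun q => likelihood D n x S q) (fun q hq => ?_) hkQ
        simp only [hQ, Finset.mem_filter, Finset.mem_image, Finset.mem_univ, true_and] at hq
        obtain ⟨⟨k, rfl⟩, -⟩ := hq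
        exact likelihood_nonneg fun s j => by positivity
    calc marginalLikelihood D n x S
        ≤ ∫ _, r ^ n * ∑ q ∈ Q, likelihood D n x S q ∂paramPrior S :=
          integral_mono_ae (integrable_likelihood D n x) (integrable_const _) key
      _ = _ := by simp

end Prior

/-! ### Bayes factors and the posterior -/

theorem mem_modelClass_iff {D : ℕ} {S : PTree m} : S ∈ modelClass m D ↔ S.depth ≤ D := by
  simp [modelClass]

theorem marginalLikelihood_pos {T : PTree m} {θ : Params T} (hθ : ∀ s j, 0 < θ s j)
    (hsum : ∀ s, ∑ j, θ s j = 1) (D n : ℕ) (x : ℕ → Fin m) :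
    0 < marginalLikelihood D n x T := by
  obtain ⟨b, hb, h⟩ := exists_mul_likelihood_le_marginalLikelihood hθ hsum one_lt_two
  exact pos_of_mul_pos_right ((mul_pos hb (likelihood_pos hθ)).trans_le (h D n x)) (by positivity)

/-- The Bayes factor of any other model against the complete minimal one decays exponentially. -/
theorem IsVariableMemoryChain.exists_rate_marginalLikelihood_le {Ω : Type*} [MeasurableSpace Ω]
    {μ : Measure Ω} [IsProbabilityMeasure μ] {X : ℕ → Ω → Fin m} {D : ℕ} {T S : PTree m}
    {θ : Params T} (h : IsVariableMemoryChain D T θ μ X) (hpos : ∀ s j, 0 < θ s j)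
    (hmin : IsMinimal T θ) (hT : T = PTree.complete m D) (hS : S ∈ modelClass m D) (hne : S ≠ T)
    (x₀ : Fin m) :
    ∃ c : ℝ, 0 < c ∧ ∀ᵐ ω ∂μ, ∃ C : ℝ, 0 ≤ C ∧ ∀ᶠ n : ℕ in atTop,
      marginalLikelihood D n (fun k => X k ω) S ≤
        C * Real.exp (-c * n) * marginalLikelihood D n (fun k => X k ω) T := by
  have hSD := mem_modelClass_iff.1 hS
  have hD : 1 ≤ D := by
    by_contra! hD
    have hD : D = 0 := by omega
    subst hD
    refine hne (hT ▸ PTree.eq_complete_of_le_length_path hSD (fun _ => x₀) fun p => Nat.zero_le _)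
  obtain ⟨ρ, hρ0, hρ1, hρ⟩ := exists_iterate_affinity_le hT hpos h.sum_eq_one hmin hSD hne x₀
  obtain ⟨c, C, hc, hcC⟩ := exists_pow_div_le_exp hρ0 hρ1 (Nat.succ_pos D)
  -- The factor `r ^ n` is paid twice, once for `S` and once for `T`, leaving rate `c` out of `2 *
  -- c`.
  have hr : 1 < Real.exp (c / 2) := Real.one_lt_exp_iff.2 (by linarith)
  obtain ⟨Q, hQ, hQle⟩ := exists_marginalLikelihood_le_sum S hr
  obtain ⟨b, hb, hble⟩ := exists_mul_likelihood_le_marginalLikelihood hpos h.sum_eq_one hr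
  refine ⟨c, hc, ?_⟩
  have hae : ∀ᵐ ω ∂μ, ∀ q ∈ Q, ∀ᶠ n : ℕ in atTop, likelihood D n (fun k => X k ω) S q ≤
      Real.exp (-(2 * c) * n) * likelihood D n (fun k => X k ω) T θ :=
    (Finset.eventually_all Q).2 fun q hq =>
      h.ae_eventually_likelihood_le hD hpos (hQ q hq).1 x₀ hc fun n p =>
        (hρ q (hQ q hq).1 (hQ q hq).2 n p).trans (hcC n)
  filter_upwards [hae] with ω hω
  refine ⟨Q.card / b, by positivity, ?_⟩
  filter_upwards [(Finset.eventually_all Q).2 hω] with n hn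
  set x : ℕ → Fin m := fun k => X k ω
  have hexp : Real.exp (c / 2) ^ n * Real.exp (c / 2) ^ n * Real.exp (-(2 * c) * n) =
      Real.exp (-c * n) := by
    rw [← Real.exp_nat_mul, ← Real.exp_add, ← Real.exp_add]
    congr 1
    ring
  have hlik : likelihood D n x T θ ≤ Real.exp (c / 2) ^ n * marginalLikelihood D n x T / b := by
    rw [le_div_iff₀ hb, mul_comm]
    exact hble D n x
  calc marginalLikelihood D n x S
      ≤ Real.exp (c / 2) ^ n * ∑ q ∈ Q, likelihood D n x S q := hQle D n x
    _ ≤ Real.exp (c / 2) ^ n *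
        (Q.card * (Real.exp (-(2 * c) * n) * likelihood D n x T θ)) := by
        refine mul_le_mul_of_nonneg_left ?_ (by positivity)
        rw [← nsmul_eq_mul]
        exact Finset.sum_le_card_nsmul Q _ _ hn
    _ ≤ Real.exp (c / 2) ^ n * (Q.card * (Real.exp (-(2 * c) * n) *
        (Real.exp (c / 2) ^ n * marginalLikelihood D n x T / b))) := by gcongr
    _ = Q.card / b * Real.exp (-c * n) * marginalLikelihood D n x T := by
        rw [← hexp]
        ring

theorem modelPrior_pos (D : ℕ) {β : ℝ} (h0 : 0 < β) (h1 : β < 1) (S : PTree m) :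
    0 < modelPrior D β S :=
  mul_pos (pow_pos (Real.rpow_pos_of_pos (by linarith) _) _) (pow_pos h0 _)

/-- The posterior mass of the other models is at most the sum of their posterior odds. -/
theorem one_sub_posterior_le {D n : ℕ} {β : ℝ} {x : ℕ → Fin m} {T : PTree m}
    [DecidableEq (PTree m)] (hT : T ∈ modelClass m D) (hprior : ∀ S : PTree m, 0 < modelPrior D β S)
    (hpos : 0 < marginalLikelihood D n x T) {C : PTree m → ℝ} {r : ℝ}
    (h : ∀ S ∈ (modelClass m D).erase T,
      marginalLikelihood D n x S ≤ C S * r * marginalLikelihood D n x T) :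
    0 ≤ 1 - posterior D β n x T ∧ 1 - posterior D β n x T ≤
      (∑ S ∈ (modelClass m D).erase T, modelPrior D β S * C S / modelPrior D β T) * r := by
  have hw : 0 < modelPrior D β T * marginalLikelihood D n x T := mul_pos (hprior T) hpos
  have hR : 0 ≤ ∑ S ∈ (modelClass m D).erase T, modelPrior D β S * marginalLikelihood D n x S :=
    Finset.sum_nonneg fun S _ => mul_nonneg (hprior S).le (marginalLikelihood_nonneg D n x)
  have hle : ∑ S ∈ (modelClass m D).erase T, modelPrior D β S * marginalLikelihood D n x S ≤
      (∑ S ∈ (modelClass m D).erase T, modelPrior D β S * C S / modelPrior D β T) * r *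
        (modelPrior D β T * marginalLikelihood D n x T) := by
    rw [Finset.sum_mul, Finset.sum_mul]
    refine Finset.sum_le_sum fun S hS => ?_
    refine (mul_le_mul_of_nonneg_left (h S hS) (hprior S).le).trans_eq ?_
    have := (hprior T).ne'
    field_simp
  rw [posterior, ← Finset.add_sum_erase _ _ hT, one_sub_div (by positivity), add_sub_cancel_left]
  refine ⟨by positivity, ?_⟩
  refine le_trans (div_le_div_of_nonneg_left hR hw (by linarith)) ?_
  rwa [div_le_iff₀ hw]

end BCT

theorem corollary4p1 {m D : ℕ} (hm : 2 ≤ m)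
    {Ω : Type*} [MeasurableSpace Ω] (μ : Measure Ω) [IsProbabilityMeasure μ]
    (X : ℕ → Ω → Fin m) (T : BCT.PTree m) (θ : BCT.Params T)
    (hX : BCT.IsVariableMemoryChain D T θ μ X) (hpos : BCT.IsPositive θ)
    (hmin : BCT.IsMinimal T θ) (hT : T = BCT.PTree.complete m D) :
    ∃ c : ℝ, 0 < c ∧ ∀ β : ℝ, 0 < β → β < 1 → ∀ᵐ ω ∂μ,
      Tendsto (fun n : ℕ => BCT.posterior D β n (fun k => X k ω) T) atTop (𝓝 1) ∧
      (fun n : ℕ => 1 - BCT.posterior D β n (fun k => X k ω) T)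
        =O[atTop] fun n : ℕ => Real.exp (-c * n) := by
  classical
  have hθ : ∀ s j, 0 < θ s j := fun s j => (hX.nonneg s j).lt_of_ne' (hpos s j)
  have hrate : ∀ S : (BCT.modelClass m D).erase T, ∃ c : ℝ, 0 < c ∧ ∀ᵐ ω ∂μ, ∃ C : ℝ, 0 ≤ C ∧
      ∀ᶠ n : ℕ in atTop, BCT.marginalLikelihood D n (fun k => X k ω) S ≤
        C * Real.exp (-c * n) * BCT.marginalLikelihood D n (fun k => X k ω) T := fun S =>
    hX.exists_rate_marginalLikelihood_le hθ hmin hT (Finset.mem_of_mem_erase S.2)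
      (Finset.ne_of_mem_erase S.2) ⟨0, by omega⟩
  choose c hc hcS using hrate
  -- The least of finitely many rates, chosen before `β`. For `D = 0` there are no competitors and
  -- any positive value serves.
  obtain ⟨c₀, hc₀, hcle⟩ := BCT.exists_pos_forall_le (f := fun S (_ : Unit) => c S)
    fun S _ => hc S
  refine ⟨c₀, hc₀, fun β hβ0 hβ1 => ?_⟩
  have hprior := BCT.modelPrior_pos (m := m) D hβ0 hβ1
  filter_upwards [eventually_all.2 hcS] with ω hω
  choose C hC0 hC using hω
  have hO : (fun n : ℕ => 1 - BCT.posterior D β n (fun k => X k ω) T)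
      =O[atTop] fun n : ℕ => Real.exp (-c₀ * n) := by
    refine IsBigO.of_bound (∑ S ∈ (BCT.modelClass m D).erase T, BCT.modelPrior D β S *
      (if h : S ∈ (BCT.modelClass m D).erase T then C ⟨S, h⟩ else 0) / BCT.modelPrior D β T) ?_
    filter_upwards [eventually_all.2 hC] with n hn
    have hpost := BCT.one_sub_posterior_le (r := Real.exp (-c₀ * n))
      (C := fun S => if h : S ∈ (BCT.modelClass m D).erase T then C ⟨S, h⟩ else 0)
      hX.mem_modelClass hprior
      (BCT.marginalLikelihood_pos hθ hX.sum_eq_one D n fun k => X k ω) fun S hS => by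
        refine (hn ⟨S, hS⟩).trans ?_
        rw [dif_pos hS]
        refine mul_le_mul_of_nonneg_right (mul_le_mul_of_nonneg_left (Real.exp_le_exp.2 ?_)
          (hC0 _)) (BCT.marginalLikelihood_nonneg _ _ _)
        nlinarith [hcle ⟨S, hS⟩ (), (Nat.cast_nonneg n : (0 : ℝ) ≤ n)]
    rw [Real.norm_of_nonneg hpost.1, Real.norm_of_nonneg (Real.exp_pos _).le]
    exact hpost.2
  refine ⟨?_, hO⟩
  have hexp : Tendsto (fun n : ℕ => Real.exp (-c₀ * n)) atTop (𝓝 0) :=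
    Real.tendsto_exp_atBot.comp
      (tendsto_natCast_atTop_atTop.const_mul_atTop_of_neg (neg_neg_of_pos hc₀))
  simpa using (hO.trans_tendsto hexp).const_sub 1
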